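/- For a graph $G$ and a positive integer $m$, let the walk-power $G^{(m)}$ be the graph on the vertex set $V(G)$ in which two distinct vertices $x$ and $y$ are adjacent if and only if $G$ has a walk of length exactly $m$ between $x$ and $y$. The odd-girth of $G$ is the length of a shortest odd cycle of $G$, and $\omega$ denotes the clique number. For every integer $k \ge 1$ there is a finite simple planar graph $G$ of odd-girth $2k+1$ such that $\omega\bigl(G^{(2k-1)}\bigr) \ge 2^{2k}$. -/

import Mathlib

namespace SimpleGraph

variable {V : Type*}

/-- The `k`-th walk-power of `G`: two distinct vertices are adjacent when `G` has a walk of length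
exactly `k` between them. (For `k` odd and `G` without odd cycles of length at most `k`, no vertex
has a closed walk of length `k`, so no loop is being discarded here.) -/
def walkPower (G : SimpleGraph V) (k : ℕ) : SimpleGraph V where
  Adj x y := x ≠ y ∧ ∃ p : G.Walk x y, p.length = k
  symm := ⟨by
    rintro x y ⟨hne, p, hp⟩
    exact ⟨hne.symm, p.reverse, by rw [Walk.length_reverse, hp]⟩⟩
  loopless := ⟨fun _ h => h.1 rfl⟩

/-- The odd-girth of `G`: the length of a shortest odd cycle, or `⊤` if there is none. -/
noncomputable def oddGirth (G : SimpleGraph V) : ℕ∞ :=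
  ⨅ a, ⨅ w : G.Walk a a, ⨅ _ : w.IsCycle ∧ Odd w.length, (w.length : ℕ∞)

/-- A planar embedding of `G`: distinct vertices are distinct points of the plane, every edge is a
simple arc joining its ends, an arc contains no vertex other than its ends, and two different
arcs meet only in vertices. (Only the topology of the plane is used, so it is taken as `ℝ × ℝ`;
the values of `arc` outside the edge set are irrelevant.) -/
structure PlanarEmbedding (G : SimpleGraph V) where
  /-- the point that represents a vertex -/
  point : V → ℝ × ℝ
  /-- the arc that represents an edge, as a subset of the plane -/
  arc : Sym2 V → Set (ℝ × ℝ)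
  point_injective : Function.Injective point
  isArc : ∀ u v : V, G.Adj u v →
    ∃ γ : _root_.Path (point u) (point v), Function.Injective γ ∧ Set.range γ = arc s(u, v)
  eq_of_point_mem_arc : ∀ e ∈ G.edgeSet, ∀ w : V, point w ∈ arc e → w ∈ e
  arc_inter_arc : ∀ e ∈ G.edgeSet, ∀ f ∈ G.edgeSet, e ≠ f → arc e ∩ arc f ⊆ Set.range point

/-- A graph is planar if it has a planar embedding. -/
def IsPlanar (G : SimpleGraph V) : Prop := Nonempty G.PlanarEmbedding

end SimpleGraph

/-! ### Shortest odd closed walks are cycles -/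

namespace SimpleGraph

variable {V : Type*} {G : SimpleGraph V}

/-! The graph is built recursively between two terminals `u` and `w`, keeping a set of `2 ^ (n + 1)`
vertices, each on a walk of length `n + 1` from `u` to `w`, any two joined by an odd walk of length
at most `2 * k - 1`. One step takes new vertices `p`, `q`, single edges `u p` and `q w`, paths of
length `2 * k - n` from `u` to `w` and from `p` to `q` (`n` being the new index), and copies of the
old graph between `u, q` and between `p, w`. The chosen set doubles. Vertices in different copies
are joined by one of the four routes around this frame: two routes of equal parity have lengths
adding up to at most `4 * k`, so if they are odd, one has length at most `2 * k - 1`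
(`exists_odd_walk`, `exists_clique`). Odd walks are then padded to length exactly `2 * k - 1`.

Short odd closed walks are excluded by an edge colouring with `2 * k + 1` colours. Vertices carry
binary vectors that change by a fixed step along each colour; an odd closed walk must use every
colour an odd number of times, so it has length at least `2 * k + 1` (`IsColoured.le_length`). The
labels fit around the frame because all the steps add up to `0`. At the last stage the path from `u`
to `w` is one edge, which closes a walk of length `2 * k` to one of length `2 * k + 1`.

Planarity comes from a straight-line drawing: the old drawing fits into a triangle, and two affine
images of it are placed inside faces of the frame, meeting the rest only in corners
(`isPlane_glue`). -/

theorem Walk.isPath_or_exists_shorter {a b : V} (p : G.Walk a b) :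
    p.IsPath ∨ (∃ q : G.Walk a b, q.length < p.length ∧ (Odd q.length ↔ Odd p.length)) ∨
      ∃ (c : V) (q : G.Walk c c), q.length ≤ p.length ∧ Odd q.length := by
  classical
  induction p with
  | nil => exact Or.inl Walk.IsPath.nil
  | @cons u v w h p ih =>
    rcases ih with hp | ⟨q, hq, hodd⟩ | ⟨c, q, hq, hodd⟩
    · by_cases hu : u ∈ p.support
      · have hlen : (p.takeUntil u hu).length + (p.dropUntil u hu).length = p.length := by
          rw [← Walk.length_append, Walk.take_spec]
        right
        -- A return to `u` cuts off a closed walk: if odd, it is the third alternative; if even,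
        -- deleting it preserves parity.
        by_cases ho : Odd (Walk.cons h (p.takeUntil u hu)).length
        · exact Or.inr ⟨u, _, by simp only [Walk.length_cons]; omega, ho⟩
        · refine Or.inl ⟨p.dropUntil u hu, by simp only [Walk.length_cons]; omega, ?_⟩
          simp only [Walk.length_cons, Nat.odd_iff] at ho ⊢
          omega
      · exact Or.inl ((Walk.cons_isPath_iff h p).2 ⟨hp, hu⟩)
    · refine Or.inr (Or.inl ⟨Walk.cons h q, by simpa using hq, ?_⟩)
      simp only [Walk.length_cons, Nat.odd_iff] at hodd ⊢
      omega
    · exact Or.inr (Or.inr ⟨c, q, by simp only [Walk.length_cons]; omega, hodd⟩)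

theorem Walk.isCycle_of_odd_of_minimal {a : V} (p : G.Walk a a) (hodd : Odd p.length)
    (hmin : ∀ (c : V) (q : G.Walk c c), Odd q.length → p.length ≤ q.length) : p.IsCycle := by
  cases p with
  | nil => simp at hodd
  | @cons _ v _ h p =>
    simp only [Walk.length_cons] at hodd hmin
    rw [Walk.cons_isCycle_iff]
    have hp : p.IsPath := by
      rcases p.isPath_or_exists_shorter with hp | ⟨q, hq, ho⟩ | ⟨c, q, hq, ho⟩
      · exact hp
      · have := hmin a (Walk.cons h q) (by
          simp only [Walk.length_cons, Nat.odd_iff] at ho hodd ⊢; omega)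
        simp only [Walk.length_cons] at this
        omega
      · have := hmin c q ho
        omega
    refine ⟨hp, fun he => ?_⟩
    rw [Sym2.eq_swap] at he
    -- A path that contains the edge between its own ends is that edge, so the closed walk would
    -- have even length 2.
    have := hp.length_eq_one_of_mem_edges he
    rw [this] at hodd
    exact absurd hodd (by decide)

theorem oddGirth_eq_of_closed_walk {n : ℕ} {a : V} (p : G.Walk a a) (hp : p.length = n)
    (hn : Odd n) (hmin : ∀ (c : V) (q : G.Walk c c), Odd q.length → n ≤ q.length) :
    G.oddGirth = (n : ℕ∞) := by
  subst hp
  refine le_antisymm ?_ ?_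
  · exact iInf_le_of_le a (iInf_le_of_le p
      (iInf_le_of_le ⟨p.isCycle_of_odd_of_minimal hn hmin, hn⟩ le_rfl))
  · exact le_iInf fun c => le_iInf fun q => le_iInf fun hq => by exact_mod_cast hmin c q hq.2

/-- Going back and forth along the first edge adds 2 to the length. This turns odd walks that are
too short into walks of the exact length of the walk-power. -/
theorem Walk.exists_length_add_two_mul {a b : V} (p : G.Walk a b) (hp : 0 < p.length) (i : ℕ) :
    ∃ q : G.Walk a b, q.length = p.length + 2 * i := by
  cases p with
  | nil => simp at hp
  | @cons _ v _ h p =>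
    induction i with
    | zero => exact ⟨Walk.cons h p, rfl⟩
    | succ i ih =>
      obtain ⟨q, hq⟩ := ih
      exact ⟨Walk.cons h (Walk.cons h.symm q), by simp only [Walk.length_cons] at hq ⊢; omega⟩

/-- Only isolated vertices lie outside `s`. The graph of a drawing lives on all labelled points, and
this allows its restriction to the finite set of ends of edges. -/
theorem exists_walk_induce {s : Set V} (hs : ∀ a b, G.Adj a b → a ∈ s) {a b : V}
    (ha : a ∈ s) (hb : b ∈ s) (p : G.Walk a b) :
    ∃ q : (G.induce s).Walk ⟨a, ha⟩ ⟨b, hb⟩, q.length = p.length := by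
  induction p with
  | nil => exact ⟨Walk.nil, rfl⟩
  | @cons u v w h p ih =>
    obtain ⟨q, hq⟩ := ih (hs v u h.symm) hb
    exact ⟨Walk.cons (show (G.induce s).Adj ⟨u, ha⟩ ⟨v, hs v u h.symm⟩ from h) q, by simp [hq]⟩

end SimpleGraph

/-! ### Straight-line drawings with labelled vertices -/

/-- A straight-line drawing: a set of edges, each given by its ends, which are points of the plane
together with a label. -/
abbrev Drawing (L : Type*) := Set (((ℝ × ℝ) × L) × ((ℝ × ℝ) × L))

namespace Drawing

variable {L : Type*}

/-- `v` is an end of the edge `e`. -/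
def IsEnd (v : (ℝ × ℝ) × L) (e : ((ℝ × ℝ) × L) × ((ℝ × ℝ) × L)) : Prop := v = e.1 ∨ v = e.2

/-- The segment that represents an edge. -/
def seg (e : ((ℝ × ℝ) × L) × ((ℝ × ℝ) × L)) : Set (ℝ × ℝ) := segment ℝ e.1.1 e.2.1

/-- No edge is degenerate, and different edges meet only in common labelled ends. -/
def IsPlane (D : Drawing L) : Prop :=
  (∀ e ∈ D, e.1.1 ≠ e.2.1) ∧
    ∀ e ∈ D, ∀ f ∈ D, e ≠ f → ∀ x ∈ seg e, x ∈ seg f → ∃ v, v.1 = x ∧ IsEnd v e ∧ IsEnd v f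

/-- Every edge through the point of `v` has `v` as an end. -/
def IsTerminal (D : Drawing L) (v : (ℝ × ℝ) × L) : Prop :=
  ∀ e ∈ D, v.1 ∈ seg e → IsEnd v e

/-- All edges lie in the region `R`. -/
def Within (D : Drawing L) (R : Set (ℝ × ℝ)) : Prop := ∀ e ∈ D, seg e ⊆ R

/-- The graph of a drawing. -/
def graph (D : Drawing L) : SimpleGraph ((ℝ × ℝ) × L) := SimpleGraph.fromRel fun a b => (a, b) ∈ D

/-- The ends of the edges of a drawing. -/
def vertexSet (D : Drawing L) : Set ((ℝ × ℝ) × L) := Prod.fst '' D ∪ Prod.snd '' D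

theorem IsEnd.fst_mem_seg {v : (ℝ × ℝ) × L} {e} (h : IsEnd v e) : v.1 ∈ seg e := by
  rcases h with rfl | rfl
  · exact left_mem_segment ℝ _ _
  · exact right_mem_segment ℝ _ _

theorem mem_vertexSet_iff {D : Drawing L} {v} : v ∈ D.vertexSet ↔ ∃ e ∈ D, IsEnd v e := by
  simp only [vertexSet, IsEnd, Set.mem_union, Set.mem_image]
  constructor
  · rintro (⟨e, he, rfl⟩ | ⟨e, he, rfl⟩)
    · exact ⟨e, he, Or.inl rfl⟩
    · exact ⟨e, he, Or.inr rfl⟩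
  · rintro ⟨e, he, rfl | rfl⟩
    · exact Or.inl ⟨e, he, rfl⟩
    · exact Or.inr ⟨e, he, rfl⟩

theorem adj_iff {D : Drawing L} {a b} : D.graph.Adj a b ↔ a ≠ b ∧ ((a, b) ∈ D ∨ (b, a) ∈ D) :=
  SimpleGraph.fromRel_adj _ _ _

theorem mem_vertexSet_of_adj {D : Drawing L} {a b} (h : D.graph.Adj a b) : a ∈ D.vertexSet := by
  rcases (adj_iff.1 h).2 with h | h
  · exact mem_vertexSet_iff.2 ⟨_, h, Or.inl rfl⟩
  · exact mem_vertexSet_iff.2 ⟨_, h, Or.inr rfl⟩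

theorem IsPlane.eq_of_isEnd {D : Drawing L} (h : D.IsPlane) {e} (he : e ∈ D) {v w}
    (hv : IsEnd v e) (hw : IsEnd w e) (hvw : v.1 = w.1) : v = w := by
  have := h.1 e he
  rcases hv with rfl | rfl <;> rcases hw with rfl | rfl <;>
    first | rfl | exact absurd hvw this | exact absurd hvw.symm this

theorem IsPlane.isEnd_of_mem {D : Drawing L} (h : D.IsPlane) {e f} (he : e ∈ D) (hf : f ∈ D) {w}
    (hw : IsEnd w f) (hwe : w.1 ∈ seg e) : IsEnd w e := by
  by_cases hef : e = f
  · exact hef ▸ hw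
  · obtain ⟨t, htx, hte, htf⟩ := h.2 e he f hf hef _ hwe hw.fst_mem_seg
    exact h.eq_of_isEnd hf htf hw htx ▸ hte

/-- Edges meet only in common labelled ends, so a point cannot carry two labels. Labelled vertices
can therefore serve as points of a planar embedding. -/
theorem IsPlane.injOn_fst {D : Drawing L} (h : D.IsPlane) : Set.InjOn Prod.fst D.vertexSet := by
  intro v hv w hw hvw
  obtain ⟨e, he, hve⟩ := mem_vertexSet_iff.1 hv
  obtain ⟨f, hf, hwf⟩ := mem_vertexSet_iff.1 hw
  exact h.eq_of_isEnd he hve (h.isEnd_of_mem he hf hwf (hvw ▸ hve.fst_mem_seg)) hvw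

/-- The segment between the points of two vertices. -/
def symSeg {s : Set ((ℝ × ℝ) × L)} : Sym2 s → Set (ℝ × ℝ) :=
  Sym2.lift ⟨fun a b => segment ℝ a.1.1 b.1.1, fun _ _ => segment_symm ℝ _ _⟩

theorem exists_edge {D : Drawing L} (e : Sym2 D.vertexSet)
    (he : e ∈ (D.graph.induce D.vertexSet).edgeSet) :
    ∃ f ∈ D, symSeg e = seg f ∧ (∀ w : D.vertexSet, w ∈ e ↔ IsEnd w.1 f) := by
  induction e using Sym2.ind with
  | h a b =>
    have hab : D.graph.Adj a.1 b.1 := he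
    rcases (adj_iff.1 hab).2 with h | h
    · exact ⟨_, h, rfl, fun w => by simp [IsEnd, Subtype.ext_iff]⟩
    · exact ⟨_, h, segment_symm ℝ _ _, fun w => by simp [IsEnd, Subtype.ext_iff, or_comm]⟩

theorem IsPlane.isPlanar {D : Drawing L} (h : D.IsPlane) :
    (D.graph.induce D.vertexSet).IsPlanar := by
  refine ⟨⟨fun v => v.1.1, symSeg, fun v w hvw => Subtype.ext (h.injOn_fst v.2 w.2 hvw), ?_, ?_, ?_⟩⟩
  · intro u v huv
    refine ⟨Path.segment u.1.1 v.1.1, ?_, Path.range_segment _ _⟩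
    have hne : u.1.1 ≠ v.1.1 := fun he =>
      huv.ne (Subtype.ext (h.injOn_fst u.2 v.2 he))
    intro s t hst
    exact Subtype.ext (AffineMap.lineMap_injective ℝ hne (by simpa [Path.segment] using hst))
  · intro e he w hw
    obtain ⟨f, hf, hseg, hend⟩ := exists_edge e he
    obtain ⟨f', hf', hw'⟩ := mem_vertexSet_iff.1 w.2
    rw [hseg] at hw
    exact (hend w).2 (h.isEnd_of_mem hf hf' hw' hw)
  · rintro e he f hf hef x ⟨hxe, hxf⟩
    obtain ⟨e', he', hsege, hende⟩ := exists_edge e he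
    obtain ⟨f', hf', hsegf, hendf⟩ := exists_edge f hf
    have hne : e' ≠ f' := by
      rintro rfl
      exact hef (Sym2.ext fun w => (hende w).trans (hendf w).symm)
    rw [hsege] at hxe
    rw [hsegf] at hxf
    obtain ⟨v, hv, hve, -⟩ := h.2 e' he' f' hf' hne x hxe hxf
    exact ⟨⟨v, mem_vertexSet_iff.2 ⟨e', he', hve⟩⟩, hv⟩

theorem IsTerminal.of_notMem {D : Drawing L} {R : Set (ℝ × ℝ)} (h : D.Within R)
    {v : (ℝ × ℝ) × L} (hv : v.1 ∉ R) : D.IsTerminal v :=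
  fun e he hve => absurd (h e he hve) hv

theorem IsTerminal.union {D E : Drawing L} {v : (ℝ × ℝ) × L} (hD : D.IsTerminal v)
    (hE : E.IsTerminal v) : IsTerminal (D ∪ E) v := by
  rintro e (he | he)
  · exact hD e he
  · exact hE e he

/-- Two drawings whose edges meet only in common terminals. -/
def Compatible (D E : Drawing L) : Prop :=
  ∀ e ∈ D, ∀ f ∈ E, ∀ x ∈ seg e, x ∈ seg f → ∃ v, v.1 = x ∧ IsEnd v e ∧ IsEnd v f

/-- This reduces compatibility to linear inequalities: only the points common to the two regions
matter. -/
theorem Compatible.of_within {D E : Drawing L} {R S : Set (ℝ × ℝ)} (hD : D.Within R)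
    (hE : E.Within S)
    (h : ∀ x ∈ R, x ∈ S → ∃ v, v.1 = x ∧ D.IsTerminal v ∧ E.IsTerminal v) : Compatible D E := by
  intro e he f hf x hxe hxf
  obtain ⟨v, rfl, hvD, hvE⟩ := h x (hD e he hxe) (hE f hf hxf)
  exact ⟨v, rfl, hvD e he hxe, hvE f hf hxf⟩

theorem Compatible.union_left {D D' E : Drawing L} (h : Compatible D E) (h' : Compatible D' E) :
    Compatible (D ∪ D') E := by
  rintro e (he | he)
  · exact h e he
  · exact h' e he

theorem IsPlane.union {D E : Drawing L} (hD : D.IsPlane) (hE : E.IsPlane) (h : Compatible D E) :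
    IsPlane (D ∪ E) := by
  refine ⟨?_, ?_⟩
  · rintro e (he | he)
    · exact hD.1 e he
    · exact hE.1 e he
  · rintro e (he | he) f (hf | hf) hef x hxe hxf
    · exact hD.2 e he f hf hef x hxe hxf
    · exact h e he f hf x hxe hxf
    · obtain ⟨v, hv, h1, h2⟩ := h f hf e he x hxf hxe
      exact ⟨v, hv, h2, h1⟩
    · exact hE.2 e he f hf hef x hxe hxf

theorem Within.union {D E : Drawing L} {R : Set (ℝ × ℝ)} (hD : D.Within R) (hE : E.Within R) :
    Within (D ∪ E) R := by
  rintro e (he | he)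
  · exact hD e he
  · exact hE e he

theorem Within.mono {D : Drawing L} {R S : Set (ℝ × ℝ)} (hD : D.Within R) (h : R ⊆ S) :
    D.Within S := fun e he => (hD e he).trans h

/-- The image of a drawing under an affine map, with all labels translated by `l`. -/
def move [Add L] (φ : (ℝ × ℝ) →ᵃ[ℝ] (ℝ × ℝ)) (l : L) (v : (ℝ × ℝ) × L) : (ℝ × ℝ) × L :=
  (φ v.1, v.2 + l)

section move

variable [AddGroup L] {φ : (ℝ × ℝ) →ᵃ[ℝ] (ℝ × ℝ)} {l : L} {D : Drawing L}

theorem move_injective (hφ : Function.Injective φ) (l : L) : Function.Injective (move φ l) := by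
  rintro ⟨x, a⟩ ⟨y, b⟩ h
  simp only [move, Prod.mk.injEq, add_left_inj] at h
  exact Prod.ext (hφ h.1) h.2

theorem seg_map (e : ((ℝ × ℝ) × L) × ((ℝ × ℝ) × L)) :
    seg (Prod.map (move φ l) (move φ l) e) = φ '' seg e :=
  (image_segment ℝ φ e.1.1 e.2.1).symm

theorem IsEnd.map {v : (ℝ × ℝ) × L} {e} (h : IsEnd v e) :
    IsEnd (move φ l v) (Prod.map (move φ l) (move φ l) e) := by
  rcases h with rfl | rfl
  · exact Or.inl rfl
  · exact Or.inr rfl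

theorem IsPlane.map (h : D.IsPlane) (hφ : Function.Injective φ) (l : L) :
    IsPlane (Prod.map (move φ l) (move φ l) '' D) := by
  refine ⟨?_, ?_⟩
  · rintro _ ⟨e, he, rfl⟩ heq
    exact h.1 e he (hφ heq)
  · rintro _ ⟨e, he, rfl⟩ _ ⟨f, hf, rfl⟩ hef x hxe hxf
    rw [seg_map] at hxe hxf
    obtain ⟨y, hye, rfl⟩ := hxe
    obtain ⟨z, hzf, hzy⟩ := hxf
    rw [hφ hzy] at hzf
    obtain ⟨v, rfl, hve, hvf⟩ := h.2 e he f hf (fun h => hef (h ▸ rfl)) y hye hzf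
    exact ⟨move φ l v, rfl, hve.map, hvf.map⟩

theorem IsTerminal.map {v : (ℝ × ℝ) × L} (h : D.IsTerminal v) (hφ : Function.Injective φ) (l : L) :
    IsTerminal (Prod.map (move φ l) (move φ l) '' D) (move φ l v) := by
  rintro _ ⟨e, he, rfl⟩ hv
  rw [seg_map] at hv
  obtain ⟨y, hye, hy⟩ := hv
  rw [hφ hy] at hye
  exact (h e he hye).map

theorem Within.map {R : Set (ℝ × ℝ)} (h : D.Within R) (φ : (ℝ × ℝ) →ᵃ[ℝ] (ℝ × ℝ)) (l : L) :
    Within (Prod.map (move φ l) (move φ l) '' D) (φ '' R) := by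
  rintro _ ⟨e, he, rfl⟩
  rw [seg_map]
  exact Set.image_mono (h e he)

end move

end Drawing

namespace Drawing

/-! ### Walks in drawings -/

section HasWalk

variable {L : Type*}

/-- The drawing has a walk of length `m` from `a` to `b`. -/
def HasWalk (D : Drawing L) (m : ℕ) (a b : (ℝ × ℝ) × L) : Prop :=
  ∃ p : D.graph.Walk a b, p.length = m

variable {D E : Drawing L} {a b c : (ℝ × ℝ) × L} {m n : ℕ}

theorem HasWalk.refl (D : Drawing L) (a : (ℝ × ℝ) × L) : D.HasWalk 0 a a :=
  ⟨SimpleGraph.Walk.nil, rfl⟩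

theorem HasWalk.trans (h : D.HasWalk m a b) (h' : D.HasWalk n b c) : D.HasWalk (m + n) a c := by
  obtain ⟨p, rfl⟩ := h
  obtain ⟨q, rfl⟩ := h'
  exact ⟨p.append q, p.length_append q⟩

theorem HasWalk.symm (h : D.HasWalk m a b) : D.HasWalk m b a := by
  obtain ⟨p, rfl⟩ := h
  exact ⟨p.reverse, p.length_reverse⟩

theorem HasWalk.mono (h : D.HasWalk m a b) (hDE : D ⊆ E) : E.HasWalk m a b := by
  obtain ⟨p, rfl⟩ := h
  refine ⟨p.mapLe fun x y hxy => ?_, by simp⟩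
  rw [adj_iff] at hxy ⊢
  exact ⟨hxy.1, hxy.2.imp (@hDE _) (@hDE _)⟩

theorem HasWalk.map [AddGroup L] {φ : (ℝ × ℝ) →ᵃ[ℝ] (ℝ × ℝ)} (h : D.HasWalk m a b)
    (hφ : Function.Injective φ) (l : L) :
    HasWalk (Prod.map (move φ l) (move φ l) '' D) m (move φ l a) (move φ l b) := by
  obtain ⟨p, rfl⟩ := h
  let f : D.graph →g graph (Prod.map (move φ l) (move φ l) '' D) :=
    { toFun := move φ l
      map_rel' := by
        intro x y hxy
        rw [adj_iff] at hxy ⊢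
        exact ⟨fun h => hxy.1 (move_injective hφ l h),
          hxy.2.imp (fun h => ⟨_, h, rfl⟩) (fun h => ⟨_, h, rfl⟩)⟩ }
  exact ⟨p.map f, p.length_map f⟩

theorem hasWalk_one (h : (a, b) ∈ D) (hab : a.1 ≠ b.1) : D.HasWalk 1 a b :=
  ⟨SimpleGraph.Walk.cons (adj_iff.2 ⟨fun h => hab (h ▸ rfl), Or.inl h⟩) SimpleGraph.Walk.nil, rfl⟩

theorem HasWalk.mem_vertexSet (h : D.HasWalk m a b) (hm : 0 < m) : a ∈ D.vertexSet := by
  obtain ⟨p, rfl⟩ := h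
  cases p with
  | nil => simp at hm
  | cons h p => exact mem_vertexSet_of_adj h

end HasWalk

/-! ### Subdivided segments -/

section chain

variable {L : Type*} [AddCommGroup L]

/-- The `i`-th vertex of a segment subdivided into `N` edges, where the steps of the labels
are `g m, g (m + 1), …`. -/
noncomputable def chainVertex (g : ℕ → L) (a b : ℝ × ℝ) (l : L) (m N i : ℕ) : (ℝ × ℝ) × L :=
  (AffineMap.lineMap a b ((i : ℝ) / N), l + ∑ j ∈ Finset.range i, g (m + j))

/-- A segment subdivided into `N` edges. -/
def chain (g : ℕ → L) (a b : ℝ × ℝ) (l : L) (m N : ℕ) : Drawing L :=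
  {e | ∃ i < N, e = (chainVertex g a b l m N i, chainVertex g a b l m N (i + 1))}

variable {g : ℕ → L} {a b : ℝ × ℝ} {l : L} {m N : ℕ}

theorem chain_finite (g : ℕ → L) (a b : ℝ × ℝ) (l : L) (m N : ℕ) : (chain g a b l m N).Finite := by
  refine ((Set.finite_lt_nat N).image fun i =>
    (chainVertex g a b l m N i, chainVertex g a b l m N (i + 1))).subset ?_
  rintro _ ⟨i, hi, rfl⟩
  exact ⟨i, hi, rfl⟩

/-- With the parameter scaled by `N`, the `i`-th edge occupies the interval from `i` to `i + 1`, so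
incidences in a chain become comparisons of numbers. -/
theorem exists_of_mem_seg_chain {i : ℕ} (hi : i < N) {x : ℝ × ℝ}
    (hx : x ∈ seg (chainVertex g a b l m N i, chainVertex g a b l m N (i + 1))) :
    ∃ t : ℝ, x = AffineMap.lineMap a b (t / N) ∧ (i : ℝ) ≤ t ∧ t ≤ i + 1 := by
  have hN : (0 : ℝ) < N := by exact_mod_cast (Nat.zero_le i).trans_lt hi
  rw [seg, chainVertex, chainVertex, ← image_segment, segment_eq_Icc (by gcongr; simp)] at hx
  obtain ⟨s, ⟨h1, h2⟩, rfl⟩ := hx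
  refine ⟨s * N, by rw [mul_div_cancel_right₀ _ hN.ne'], (div_le_iff₀ hN).1 h1, ?_⟩
  have := (le_div_iff₀ hN).1 h2
  push_cast at this
  exact this

theorem lineMap_div_inj (hab : a ≠ b) (hN : N ≠ 0) {s t : ℝ} :
    (AffineMap.lineMap a b (s / N) : ℝ × ℝ) = AffineMap.lineMap a b (t / N) ↔ s = t := by
  rw [(AffineMap.lineMap_injective ℝ hab).eq_iff, div_left_inj' (by exact_mod_cast hN)]

theorem chain_within : (chain g a b l m N).Within (segment ℝ a b) := by
  rintro _ ⟨i, hi, rfl⟩ x hx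
  obtain ⟨t, rfl, h1, h2⟩ := exists_of_mem_seg_chain hi hx
  have hN : (0 : ℝ) < N := by exact_mod_cast (Nat.zero_le i).trans_lt hi
  have hi' : (i : ℝ) + 1 ≤ N := by exact_mod_cast hi
  rw [segment_eq_image_lineMap]
  refine ⟨_, ⟨div_nonneg ((Nat.cast_nonneg i).trans h1) hN.le, ?_⟩, rfl⟩
  rw [div_le_one hN]
  linarith

theorem chain_isPlane (hab : a ≠ b) : (chain g a b l m N).IsPlane := by
  refine ⟨?_, ?_⟩
  · rintro _ ⟨i, hi, rfl⟩ h
    have := (lineMap_div_inj hab (by omega)).1 h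
    push_cast at this
    linarith
  · have key : ∀ i j, i < j → j < N → ∀ x,
        x ∈ seg (chainVertex g a b l m N i, chainVertex g a b l m N (i + 1)) →
        x ∈ seg (chainVertex g a b l m N j, chainVertex g a b l m N (j + 1)) →
        j = i + 1 ∧ x = (chainVertex g a b l m N j).1 := by
      intro i j hij hj x hxi hxj
      obtain ⟨t, rfl, h1, h2⟩ := exists_of_mem_seg_chain (hij.trans hj) hxi
      obtain ⟨s, hs, h3, h4⟩ := exists_of_mem_seg_chain hj hxj
      rw [lineMap_div_inj hab (by omega)] at hs
      subst hs
      have h5 : (i : ℝ) + 1 ≤ j := by exact_mod_cast hij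
      have h6 : (j : ℝ) = i + 1 := by linarith
      refine ⟨by exact_mod_cast h6, ?_⟩
      rw [chainVertex, show t = j by linarith]
    rintro _ ⟨i, hi, rfl⟩ _ ⟨j, hj, rfl⟩ hij x hxi hxj
    rcases lt_trichotomy i j with h | rfl | h
    · obtain ⟨rfl, rfl⟩ := key i j h hj x hxi hxj
      exact ⟨_, rfl, Or.inr rfl, Or.inl rfl⟩
    · exact absurd rfl hij
    · obtain ⟨rfl, rfl⟩ := key j i h hi x hxj hxi
      exact ⟨_, rfl, Or.inl rfl, Or.inr rfl⟩

theorem chain_isTerminal_left (hab : a ≠ b) : (chain g a b l m N).IsTerminal (a, l) := by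
  rintro _ ⟨i, hi, rfl⟩ hx
  obtain ⟨t, ht, h1, h2⟩ := exists_of_mem_seg_chain hi hx
  have h0 : (AffineMap.lineMap a b ((0 : ℝ) / N) : ℝ × ℝ) = a := by simp
  have := (lineMap_div_inj hab (by omega)).1 (h0.trans ht)
  have h3 : (i : ℝ) ≤ 0 := by linarith
  have h4 : i = 0 := by exact_mod_cast le_antisymm h3 (Nat.cast_nonneg i)
  subst h4
  left
  simp [chainVertex]

theorem chain_isTerminal_right (hab : a ≠ b) {l' : L}
    (hl : l + ∑ j ∈ Finset.range N, g (m + j) = l') : (chain g a b l m N).IsTerminal (b, l') := by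
  subst hl
  rintro _ ⟨i, hi, rfl⟩ hx
  obtain ⟨t, ht, h1, h2⟩ := exists_of_mem_seg_chain hi hx
  have hN : (N : ℝ) ≠ 0 := by exact_mod_cast (by omega : N ≠ 0)
  have h0 : (AffineMap.lineMap a b ((N : ℝ) / N) : ℝ × ℝ) = b := by simp [div_self hN]
  have := (lineMap_div_inj hab (by omega)).1 (h0.trans ht)
  have h3 : (N : ℝ) ≤ i + 1 := by linarith
  have h4 : N = i + 1 := le_antisymm (by exact_mod_cast h3) hi
  right
  change _ = chainVertex g a b l m N (i + 1)
  rw [← h4]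
  exact Prod.ext h0.symm rfl

theorem chain_hasWalk (hab : a ≠ b) (hN : N ≠ 0) {l' : L}
    (hl : l + ∑ j ∈ Finset.range N, g (m + j) = l') :
    (chain g a b l m N).HasWalk N (a, l) (b, l') := by
  have key : ∀ i ≤ N, (chain g a b l m N).HasWalk i (chainVertex g a b l m N 0)
      (chainVertex g a b l m N i) := by
    intro i
    induction i with
    | zero => exact fun _ => HasWalk.refl _ _
    | succ i ih =>
      intro hi
      exact (ih (by omega)).trans (hasWalk_one ⟨i, by omega, rfl⟩
        ((chain_isPlane hab).1 _ ⟨i, by omega, rfl⟩))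
  have := key N le_rfl
  have hN' : (N : ℝ) ≠ 0 := by exact_mod_cast hN
  simpa [chainVertex, hl, div_self hN'] using this

end chain

/-! ### Labels and odd closed walks -/

/-- The step of the labels along an edge of colour `i`: it is `0` in coordinate `i` and `1`
elsewhere, so that the steps of all the colours add up to `0`. -/
def step (k i : ℕ) : Fin (2 * k + 1) → ZMod 2 := fun j => if (j : ℕ) = i then 0 else 1

/-- Each coordinate receives a 1 from all colours but one, that is `2 * k` times. -/
theorem sum_step (k : ℕ) : ∑ i ∈ Finset.range (2 * k + 1), step k i = 0 := by
  funext j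
  have h2 : (2 : ZMod 2) = 0 := rfl
  rw [Finset.sum_apply]
  simp only [step, Pi.zero_apply]
  rw [Finset.sum_ite, Finset.sum_const_zero, zero_add, Finset.sum_const, nsmul_eq_mul, mul_one]
  have : (Finset.range (2 * k + 1)).filter (fun i => ¬ (j : ℕ) = i) =
      (Finset.range (2 * k + 1)).erase j := by
    ext i
    simp [eq_comm, and_comm]
  rw [this, Finset.card_erase_of_mem (Finset.mem_range.2 j.is_lt), Finset.card_range, Nat.add_sub_cancel]
  push_cast
  rw [h2, zero_mul]

theorem add_self_label {k : ℕ} (l : Fin (2 * k + 1) → ZMod 2) : l + l = 0 :=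
  funext fun j => CharTwo.add_self_eq_zero (l j)

/-- Along every edge the label changes by the step of one of the colours. -/
def IsColoured {k : ℕ} (D : Drawing (Fin (2 * k + 1) → ZMod 2)) : Prop :=
  ∀ e ∈ D, ∃ i < 2 * k + 1, e.2.2 = e.1.2 + step k i

section coloured

variable {k : ℕ} {D E : Drawing (Fin (2 * k + 1) → ZMod 2)}

theorem IsColoured.union (hD : D.IsColoured) (hE : E.IsColoured) : IsColoured (D ∪ E) := by
  rintro e (he | he)
  · exact hD e he
  · exact hE e he

theorem IsColoured.map (h : D.IsColoured) (φ : (ℝ × ℝ) →ᵃ[ℝ] (ℝ × ℝ))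
    (l : Fin (2 * k + 1) → ZMod 2) : IsColoured (Prod.map (move φ l) (move φ l) '' D) := by
  rintro _ ⟨e, he, rfl⟩
  obtain ⟨i, hi, h⟩ := h e he
  refine ⟨i, hi, ?_⟩
  simp only [move, Prod.map, h]
  abel

theorem chain_isColoured (a b : ℝ × ℝ) (l : Fin (2 * k + 1) → ZMod 2) {m N : ℕ}
    (h : m + N ≤ 2 * k + 1) : (chain (step k) a b l m N).IsColoured := by
  rintro _ ⟨i, hi, rfl⟩
  exact ⟨m + i, by omega, by simp only [chainVertex, Finset.sum_range_succ, add_assoc]⟩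

/-- Here `n j` counts the edges of colour `j`. Coordinate `j` flips on every edge except these, and
modulo 2 adding their number to the length is the same as subtracting it. -/
theorem IsColoured.exists_count (h : D.IsColoured) {a b} (p : D.graph.Walk a b) :
    ∃ n : Fin (2 * k + 1) → ℕ, ∑ j, n j = p.length ∧
      ∀ j, b.2 j = a.2 j + p.length + n j := by
  induction p with
  | nil => exact ⟨0, by simp, by simp⟩
  | @cons u v w hadj p ih =>
    obtain ⟨n, hn, hlab⟩ := ih
    -- Orientation is immaterial, since every label is its own negative.
    have hstep : ∃ i < 2 * k + 1, v.2 = u.2 + step k i := by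
      rcases (adj_iff.1 hadj).2 with he | he
      · exact h _ he
      · obtain ⟨i, hi, h⟩ := h _ he
        refine ⟨i, hi, ?_⟩
        simp only at h
        rw [h, add_assoc, add_self_label, add_zero]
    obtain ⟨i, hi, hvu⟩ := hstep
    refine ⟨n + Pi.single ⟨i, hi⟩ 1, ?_, fun j => ?_⟩
    · simp [Finset.sum_add_distrib, hn]
    · have h2 : (2 : ZMod 2) = 0 := rfl
      rw [hlab j, hvu, SimpleGraph.Walk.length_cons]
      by_cases hj : (j : ℕ) = i
      · have : j = ⟨i, hi⟩ := Fin.ext hj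
        subst this
        simp only [Pi.add_apply, step, Pi.single_eq_same, if_true]
        push_cast
        linear_combination -h2
      · have hj' : j ≠ ⟨i, hi⟩ := fun h => hj (congrArg Fin.val h)
        simp only [Pi.add_apply, step, hj, Pi.single_eq_of_ne hj', if_false]
        push_cast
        ring

/-- Around a closed walk each coordinate returns to its value, so the count of every colour has the
parity of the length. If that is odd, no colour is missing. -/
theorem IsColoured.le_length (h : D.IsColoured) {a} (p : D.graph.Walk a a) (hp : Odd p.length) :
    2 * k + 1 ≤ p.length := by
  obtain ⟨n, hn, hlab⟩ := h.exists_count p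
  have hpos : ∀ j, 1 ≤ n j := by
    intro j
    by_contra hj
    have hj0 : n j = 0 := by omega
    have := hlab j
    rw [hj0, (ZMod.natCast_eq_one_iff_odd).2 hp] at this
    simp at this
  calc 2 * k + 1 = ∑ _j : Fin (2 * k + 1), 1 := by simp
    _ ≤ ∑ j, n j := Finset.sum_le_sum fun j _ => hpos j
    _ = p.length := hn

end coloured

end Drawing

namespace Drawing

/-! ### The recursive construction -/

/-- The affine map `(x, y) ↦ (a x + b y + e, c x + d y + f)` of the plane. -/
def planeMap (a b c d e f : ℝ) : (ℝ × ℝ) →ᵃ[ℝ] (ℝ × ℝ) where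
  toFun x := (a * x.1 + b * x.2 + e, c * x.1 + d * x.2 + f)
  linear :=
    { toFun := fun x => (a * x.1 + b * x.2, c * x.1 + d * x.2)
      map_add' := fun x y => by ext <;> simp <;> ring
      map_smul' := fun r x => by ext <;> simp <;> ring }
  map_vadd' := fun x y => by ext <;> simp <;> ring

theorem planeMap_apply (a b c d e f : ℝ) (x : ℝ × ℝ) :
    planeMap a b c d e f x = (a * x.1 + b * x.2 + e, c * x.1 + d * x.2 + f) := rfl

theorem planeMap_injective {a b c d : ℝ} (h : a * d - b * c ≠ 0) (e f : ℝ) :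
    Function.Injective (planeMap a b c d e f) := by
  intro x y hxy
  simp only [planeMap_apply, Prod.mk.injEq] at hxy
  obtain ⟨h1, h2⟩ := hxy
  refine Prod.ext (mul_left_cancel₀ h ?_) (mul_left_cancel₀ h ?_)
  · linear_combination d * h1 - b * h2
  · linear_combination a * h2 - c * h1

/-- The map that takes the triangle `(0, 0), (6, 0), (0, 6)` to `(0, 0), (1, 1), (1, 1 / 2)`. -/
noncomputable def lowerMap : (ℝ × ℝ) →ᵃ[ℝ] (ℝ × ℝ) := planeMap (1 / 6) (1 / 6) (1 / 6) (1 / 12) 0 0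

/-- The map that takes the triangle `(0, 0), (6, 0), (0, 6)` to `(0, 6), (6, 0), (2, 2)`. -/
noncomputable def upperMap : (ℝ × ℝ) →ᵃ[ℝ] (ℝ × ℝ) := planeMap 1 (1 / 3) (-1) (-2 / 3) 0 6

theorem lowerMap_injective : Function.Injective lowerMap := planeMap_injective (by norm_num) _ _

theorem upperMap_injective : Function.Injective upperMap := planeMap_injective (by norm_num) _ _

/-- The label of a vertex that is reached from a vertex with label `0` along one edge of each of the
colours `0, …, n - 1`. -/
def endLabel (k n : ℕ) : Fin (2 * k + 1) → ZMod 2 := ∑ i ∈ Finset.range n, step k i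

theorem endLabel_succ (k n : ℕ) : endLabel k (n + 1) = endLabel k n + step k n :=
  Finset.sum_range_succ _ _

/-- The colours from `n` on complement those below `n`, and all steps add up to `0`; in
characteristic 2 both partial sums agree. So the two ways around a cycle using each colour once give
the same label. -/
theorem sum_step_upper {k n : ℕ} (hn : n ≤ 2 * k + 1) :
    ∑ j ∈ Finset.range (2 * k + 1 - n), step k (n + j) = endLabel k n := by
  have h := Finset.sum_range_add (step k) n (2 * k + 1 - n)
  rw [Nat.add_sub_cancel' hn, sum_step] at h
  have h2 := add_self_label (endLabel k n)
  rw [endLabel] at h2 ⊢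
  exact add_left_cancel (h.symm.trans h2.symm)

/-- The frame of one step of the construction: a subdivided complete graph on the four vertices
`(0, 0)`, `(6, 0)`, `(0, 6)` and `(1, 1)`, without the edges from `(0, 0)` to `(1, 1)` and from
`(0, 6)` to `(6, 0)`. -/
def frame (k n : ℕ) : Drawing (Fin (2 * k + 1) → ZMod 2) :=
  chain (step k) (0, 0) (6, 0) 0 (n + 1) (2 * k + 1 - (n + 1)) ∪
    chain (step k) (0, 0) (0, 6) 0 n 1 ∪
    chain (step k) (1, 1) (6, 0) (endLabel k n) n 1 ∪
    chain (step k) (0, 6) (1, 1) (step k n) (n + 1) (2 * k + 1 - (n + 1))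

/-- The drawing between `(0, 0)` and `(6, 0)` obtained from a single edge by `n` steps; in each step
two copies of the previous drawing are inserted into a frame. -/
def piece (k : ℕ) : ℕ → Drawing (Fin (2 * k + 1) → ZMod 2)
  | 0 => chain (step k) (0, 0) (6, 0) 0 0 1
  | n + 1 => frame k (n + 1) ∪ Prod.map (move lowerMap 0) (move lowerMap 0) '' piece k n ∪
      Prod.map (move upperMap (step k (n + 1))) (move upperMap (step k (n + 1))) '' piece k n

/-- The triangle with corners `(0, 0)`, `(6, 0)` and `(0, 6)`. -/
def triangle : Set (ℝ × ℝ) := {x | 0 ≤ x.1 ∧ 0 ≤ x.2 ∧ x.1 + x.2 ≤ 6}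

/-- A region that contains the image of the triangle under `lowerMap`. -/
def lowerRegion : Set (ℝ × ℝ) := {x | x.2 ≤ x.1 ∧ x.1 ≤ 1 ∧ x.1 ≤ 2 * x.2}

/-- A region that contains the image of the triangle under `upperMap`. -/
def upperRegion : Set (ℝ × ℝ) := {x | x.1 + x.2 ≤ 6 ∧ 6 ≤ 2 * x.1 + x.2 ∧ 6 ≤ x.1 + 2 * x.2}

/-- The segment from `(0, 0)` to `(6, 0)`. -/
def bottomRegion : Set (ℝ × ℝ) := {x | x.2 = 0 ∧ 0 ≤ x.1 ∧ x.1 ≤ 6}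

/-- The segment from `(0, 0)` to `(0, 6)`. -/
def leftRegion : Set (ℝ × ℝ) := {x | x.1 = 0 ∧ 0 ≤ x.2 ∧ x.2 ≤ 6}

/-- The segment from `(1, 1)` to `(6, 0)`. -/
def rightRegion : Set (ℝ × ℝ) := {x | x.1 + 5 * x.2 = 6 ∧ 0 ≤ x.2 ∧ x.2 ≤ 1}

/-- The segment from `(0, 6)` to `(1, 1)`. -/
def middleRegion : Set (ℝ × ℝ) := {x | 5 * x.1 + x.2 = 6 ∧ 0 ≤ x.1 ∧ x.1 ≤ 1}

theorem image_lowerMap_subset : lowerMap '' triangle ⊆ lowerRegion := by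
  rintro _ ⟨x, ⟨h1, h2, h3⟩, rfl⟩
  rw [lowerMap, planeMap_apply]
  refine ⟨?_, ?_, ?_⟩ <;> dsimp only <;> linarith

theorem image_upperMap_subset : upperMap '' triangle ⊆ upperRegion := by
  rintro _ ⟨x, ⟨h1, h2, h3⟩, rfl⟩
  rw [upperMap, planeMap_apply]
  refine ⟨?_, ?_, ?_⟩ <;> dsimp only <;> linarith

theorem segment_subset_bottomRegion : segment ℝ ((0 : ℝ), (0 : ℝ)) (6, 0) ⊆ bottomRegion := by
  rintro _ ⟨s, t, hs, ht, hst, rfl⟩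
  refine ⟨?_, ?_, ?_⟩ <;> simp <;> linarith

theorem segment_subset_leftRegion : segment ℝ ((0 : ℝ), (0 : ℝ)) (0, 6) ⊆ leftRegion := by
  rintro _ ⟨s, t, hs, ht, hst, rfl⟩
  refine ⟨?_, ?_, ?_⟩ <;> simp <;> linarith

theorem segment_subset_rightRegion : segment ℝ ((1 : ℝ), (1 : ℝ)) (6, 0) ⊆ rightRegion := by
  rintro _ ⟨s, t, hs, ht, hst, rfl⟩
  refine ⟨?_, ?_, ?_⟩ <;> simp <;> linarith

theorem segment_subset_middleRegion : segment ℝ ((0 : ℝ), (6 : ℝ)) (1, 1) ⊆ middleRegion := by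
  rintro _ ⟨s, t, hs, ht, hst, rfl⟩
  refine ⟨?_, ?_, ?_⟩ <;> simp <;> linarith

/-! ### Gluing plane drawings -/

section gluing

variable {L : Type*} {A B C E F H : Drawing L} {lu lw lp lq : L}

/-- Six plane drawings in the six regions that meet only in the four corners form a plane
drawing. -/
theorem isPlane_glue
    (hA : A.IsPlane) (hB : B.IsPlane) (hC : C.IsPlane) (hE : E.IsPlane) (hF : F.IsPlane)
    (hH : H.IsPlane)
    (rA : A.Within bottomRegion) (rB : B.Within leftRegion) (rC : C.Within rightRegion)
    (rE : E.Within middleRegion) (rF : F.Within lowerRegion) (rH : H.Within upperRegion)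
    (uA : A.IsTerminal ((0, 0), lu)) (uB : B.IsTerminal ((0, 0), lu))
    (uF : F.IsTerminal ((0, 0), lu))
    (wA : A.IsTerminal ((6, 0), lw)) (wC : C.IsTerminal ((6, 0), lw))
    (wH : H.IsTerminal ((6, 0), lw))
    (pB : B.IsTerminal ((0, 6), lp)) (pE : E.IsTerminal ((0, 6), lp))
    (pH : H.IsTerminal ((0, 6), lp))
    (qC : C.IsTerminal ((1, 1), lq)) (qE : E.IsTerminal ((1, 1), lq))
    (qF : F.IsTerminal ((1, 1), lq)) :
    IsPlane (A ∪ B ∪ C ∪ E ∪ F ∪ H) ∧ Within (A ∪ B ∪ C ∪ E ∪ F ∪ H) triangle ∧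
      IsTerminal (A ∪ B ∪ C ∪ E ∪ F ∪ H) ((0, 0), lu) ∧
      IsTerminal (A ∪ B ∪ C ∪ E ∪ F ∪ H) ((6, 0), lw) := by
  have AB : Compatible A B := .of_within rA rB fun x ⟨h1, h2, h3⟩ ⟨h4, h5, h6⟩ =>
    ⟨_, Prod.ext (by dsimp only; linarith) (by dsimp only; linarith), uA, uB⟩
  have AC : Compatible A C := .of_within rA rC fun x ⟨h1, h2, h3⟩ ⟨h4, h5, h6⟩ =>
    ⟨_, Prod.ext (by dsimp only; linarith) (by dsimp only; linarith), wA, wC⟩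
  have BC : Compatible B C := .of_within rB rC fun x ⟨h1, h2, h3⟩ ⟨h4, h5, h6⟩ => by
    exfalso; linarith
  have AE : Compatible A E := .of_within rA rE fun x ⟨h1, h2, h3⟩ ⟨h4, h5, h6⟩ => by
    exfalso; linarith
  have BE : Compatible B E := .of_within rB rE fun x ⟨h1, h2, h3⟩ ⟨h4, h5, h6⟩ =>
    ⟨_, Prod.ext (by dsimp only; linarith) (by dsimp only; linarith), pB, pE⟩
  have CE : Compatible C E := .of_within rC rE fun x ⟨h1, h2, h3⟩ ⟨h4, h5, h6⟩ =>
    ⟨_, Prod.ext (by dsimp only; linarith) (by dsimp only; linarith), qC, qE⟩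
  have AF : Compatible A F := .of_within rA rF fun x ⟨h1, h2, h3⟩ ⟨h4, h5, h6⟩ =>
    ⟨_, Prod.ext (by dsimp only; linarith) (by dsimp only; linarith), uA, uF⟩
  have BF : Compatible B F := .of_within rB rF fun x ⟨h1, h2, h3⟩ ⟨h4, h5, h6⟩ =>
    ⟨_, Prod.ext (by dsimp only; linarith) (by dsimp only; linarith), uB, uF⟩
  have CF : Compatible C F := .of_within rC rF fun x ⟨h1, h2, h3⟩ ⟨h4, h5, h6⟩ =>
    ⟨_, Prod.ext (by dsimp only; linarith) (by dsimp only; linarith), qC, qF⟩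
  have EF : Compatible E F := .of_within rE rF fun x ⟨h1, h2, h3⟩ ⟨h4, h5, h6⟩ =>
    ⟨_, Prod.ext (by dsimp only; linarith) (by dsimp only; linarith), qE, qF⟩
  have AH : Compatible A H := .of_within rA rH fun x ⟨h1, h2, h3⟩ ⟨h4, h5, h6⟩ =>
    ⟨_, Prod.ext (by dsimp only; linarith) (by dsimp only; linarith), wA, wH⟩
  have BH : Compatible B H := .of_within rB rH fun x ⟨h1, h2, h3⟩ ⟨h4, h5, h6⟩ =>
    ⟨_, Prod.ext (by dsimp only; linarith) (by dsimp only; linarith), pB, pH⟩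
  have CH : Compatible C H := .of_within rC rH fun x ⟨h1, h2, h3⟩ ⟨h4, h5, h6⟩ =>
    ⟨_, Prod.ext (by dsimp only; linarith) (by dsimp only; linarith), wC, wH⟩
  have EH : Compatible E H := .of_within rE rH fun x ⟨h1, h2, h3⟩ ⟨h4, h5, h6⟩ =>
    ⟨_, Prod.ext (by dsimp only; linarith) (by dsimp only; linarith), pE, pH⟩
  have FH : Compatible F H := .of_within rF rH fun x ⟨h1, h2, h3⟩ ⟨h4, h5, h6⟩ => by
    exfalso; linarith
  refine ⟨((((hA.union hB AB).union hC (AC.union_left BC)).union hE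
      ((AE.union_left BE).union_left CE)).union hF
      (((AF.union_left BF).union_left CF).union_left EF)).union hH
      ((((AH.union_left BH).union_left CH).union_left EH).union_left FH), ?_, ?_, ?_⟩
  · refine (((((rA.mono ?_).union (rB.mono ?_)).union (rC.mono ?_)).union (rE.mono ?_)).union
      (rF.mono ?_)).union (rH.mono ?_) <;> rintro x ⟨h1, h2, h3⟩ <;>
      refine ⟨?_, ?_, ?_⟩ <;> linarith
  · refine ((((uA.union uB).union (.of_notMem rC ?_)).union (.of_notMem rE ?_)).union uF).union
      (.of_notMem rH ?_) <;>
      intro h <;> norm_num [leftRegion, rightRegion, middleRegion, lowerRegion, upperRegion] at h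
  · refine ((((wA.union (.of_notMem rB ?_)).union wC).union (.of_notMem rE ?_)).union
      (.of_notMem rF ?_)).union wH <;>
      intro h <;> norm_num [leftRegion, rightRegion, middleRegion, lowerRegion, upperRegion] at h

end gluing

/-! ### Corners, labels and planarity of the pieces -/

theorem move_lowerMap_left (k : ℕ) :
    move lowerMap 0 ((0, 0), (0 : Fin (2 * k + 1) → ZMod 2)) = ((0, 0), 0) := by
  simp [move, lowerMap, planeMap_apply]

theorem move_lowerMap_right {k : ℕ} (l : Fin (2 * k + 1) → ZMod 2) :
    move lowerMap 0 ((6, 0), l) = ((1, 1), l) := by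
  simp [move, lowerMap, planeMap_apply]

theorem move_upperMap_left {k : ℕ} (l : Fin (2 * k + 1) → ZMod 2) :
    move upperMap l ((0, 0), 0) = ((0, 6), l) := by
  simp [move, upperMap, planeMap_apply]

theorem move_upperMap_right {k : ℕ} (l l' : Fin (2 * k + 1) → ZMod 2) :
    move upperMap l ((6, 0), l') = ((6, 0), l' + l) := by
  simp [move, upperMap, planeMap_apply]

theorem sum_one_step (k n : ℕ) (l : Fin (2 * k + 1) → ZMod 2) :
    l + ∑ j ∈ Finset.range 1, step k (n + j) = l + step k n := by simp

theorem bottom_label {k n : ℕ} (hn : n + 1 ≤ 2 * k + 1) :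
    0 + ∑ j ∈ Finset.range (2 * k + 1 - (n + 1)), step k (n + 1 + j) = endLabel k (n + 1) := by
  rw [zero_add, sum_step_upper hn]

theorem middle_label {k n : ℕ} (hn : n + 1 ≤ 2 * k + 1) :
    step k n + ∑ j ∈ Finset.range (2 * k + 1 - (n + 1)), step k (n + 1 + j) = endLabel k n := by
  rw [sum_step_upper hn, endLabel_succ, add_comm (endLabel k n), ← add_assoc,
    add_self_label, zero_add]

theorem piece_isPlane {k n : ℕ} (hn : n + 1 ≤ 2 * k) :
    (piece k n).IsPlane ∧ (piece k n).Within triangle ∧ (piece k n).IsTerminal ((0, 0), 0) ∧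
      (piece k n).IsTerminal ((6, 0), endLabel k (n + 1)) := by
  have huw : ((0 : ℝ), (0 : ℝ)) ≠ (6, 0) := by simp
  have hup : ((0 : ℝ), (0 : ℝ)) ≠ (0, 6) := by simp
  have hqw : ((1 : ℝ), (1 : ℝ)) ≠ (6, 0) := by simp
  have hpq : ((0 : ℝ), (6 : ℝ)) ≠ (1, 1) := by simp
  induction n with
  | zero =>
    refine ⟨chain_isPlane huw, chain_within.mono fun x hx => ?_, chain_isTerminal_left huw,
      chain_isTerminal_right huw (by simp [endLabel])⟩
    obtain ⟨h1, h2, h3⟩ := segment_subset_bottomRegion hx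
    refine ⟨?_, ?_, ?_⟩ <;> linarith
  | succ n ih =>
    obtain ⟨h1, h2, h3, h4⟩ := ih (by omega)
    have f3 := h3.map lowerMap_injective 0
    have f4 := h4.map lowerMap_injective 0
    have g3 := h3.map upperMap_injective (step k (n + 1))
    have g4 := h4.map upperMap_injective (step k (n + 1))
    rw [move_lowerMap_left] at f3
    rw [move_lowerMap_right] at f4
    rw [move_upperMap_left] at g3
    -- Translating the upper copy by the colour of the edge from `(0, 0)` to `(0, 6)` gives `(6, 0)`
    -- the label that the bottom chain and the edge from `(1, 1)` give it.
    rw [move_upperMap_right, ← endLabel_succ] at g4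
    exact isPlane_glue (chain_isPlane huw) (chain_isPlane hup) (chain_isPlane hqw)
      (chain_isPlane hpq) (h1.map lowerMap_injective 0) (h1.map upperMap_injective _)
      (chain_within.mono segment_subset_bottomRegion)
      (chain_within.mono segment_subset_leftRegion)
      (chain_within.mono segment_subset_rightRegion)
      (chain_within.mono segment_subset_middleRegion)
      ((h2.map _ _).mono image_lowerMap_subset) ((h2.map _ _).mono image_upperMap_subset)
      (chain_isTerminal_left huw) (chain_isTerminal_left hup) f3
      (chain_isTerminal_right huw (bottom_label (by omega)))
      (chain_isTerminal_right hqw (by rw [sum_one_step, ← endLabel_succ])) g4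
      (chain_isTerminal_right hup (by rw [sum_one_step, zero_add])) (chain_isTerminal_left hpq) g3
      (chain_isTerminal_left hqw) (chain_isTerminal_right hpq (middle_label (by omega))) f4

theorem piece_finite (k n : ℕ) : (piece k n).Finite := by
  induction n with
  | zero => exact chain_finite _ _ _ _ _ _
  | succ n ih =>
    exact (((((chain_finite _ _ _ _ _ _).union (chain_finite _ _ _ _ _ _)).union
      (chain_finite _ _ _ _ _ _)).union (chain_finite _ _ _ _ _ _)).union (ih.image _)).union
      (ih.image _)

theorem piece_isColoured {k n : ℕ} (hn : n + 1 ≤ 2 * k) : (piece k n).IsColoured := by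
  induction n with
  | zero => exact chain_isColoured _ _ _ (by omega)
  | succ n ih =>
    have ih := ih (by omega)
    exact (((((chain_isColoured _ _ _ (by omega)).union (chain_isColoured _ _ _ (by omega))).union
      (chain_isColoured _ _ _ (by omega))).union (chain_isColoured _ _ _ (by omega))).union
      (ih.map _ _)).union (ih.map _ _)

/-- If `x` lies on a walk of length `n` from `u` to `q`, and `y` on one from `p` to `w`, where
`u, p, q, w` are the corners of a frame, then an odd walk shorter than `2 * k + 1` joins `x` and
`y`. -/
theorem exists_odd_walk {L : Type*} {D : Drawing L} {k n c d : ℕ}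
    {u w p q x y : (ℝ × ℝ) × L} (hn : n + 1 ≤ 2 * k) (hc : c ≤ n) (hd : d ≤ n)
    (hup : D.HasWalk 1 u p) (hqw : D.HasWalk 1 q w)
    (huw : D.HasWalk (2 * k - n) u w) (hpq : D.HasWalk (2 * k - n) p q)
    (hux : D.HasWalk c u x) (hxq : D.HasWalk (n - c) x q)
    (hpy : D.HasWalk d p y) (hyw : D.HasWalk (n - d) y w) :
    ∃ m, Odd m ∧ m ≤ 2 * k - 1 ∧ D.HasWalk m x y := by
  -- For equal parities the routes through `u p` and through `q w` are odd, and their lengths add up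
  -- to `2 * n + 2 ≤ 4 * k`; they cannot both be at least `2 * k + 1`.
  by_cases hpar : c % 2 = d % 2
  · by_cases hle : c + 1 + d ≤ 2 * k - 1
    · exact ⟨c + 1 + d, by rw [Nat.odd_iff]; omega, hle, (hux.symm.trans hup).trans hpy⟩
    · exact ⟨n - c + 1 + (n - d), by rw [Nat.odd_iff]; omega, by omega,
        (hxq.trans hqw).trans hyw.symm⟩
  -- For different parities the routes along the two long paths have the odd lengths `2 * k + c - d`
  -- and `2 * k + d - c`.
  · by_cases hle : c ≤ d
    · exact ⟨c + (2 * k - n) + (n - d), by rw [Nat.odd_iff]; omega, by omega,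
        (hux.symm.trans huw).trans hyw.symm⟩
    · exact ⟨n - c + (2 * k - n) + d, by rw [Nat.odd_iff]; omega, by omega,
        (hxq.trans hpq.symm).trans hpy⟩

/-- The positions on walks between the terminals are carried through the induction because
`exists_odd_walk` needs them to join vertices of different copies. -/
theorem exists_clique {k n : ℕ} (hn : n + 1 ≤ 2 * k) :
    ∃ S : Finset ((ℝ × ℝ) × (Fin (2 * k + 1) → ZMod 2)), S.card = 2 ^ (n + 1) ∧
      (∀ x ∈ S, ∃ c ≤ n + 1, (piece k n).HasWalk c ((0, 0), 0) x ∧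
        (piece k n).HasWalk (n + 1 - c) x ((6, 0), endLabel k (n + 1))) ∧
      ∀ x ∈ S, ∀ y ∈ S, x ≠ y → ∃ m, Odd m ∧ m ≤ 2 * k - 1 ∧ (piece k n).HasWalk m x y := by
  classical
  have huw : ((0 : ℝ), (0 : ℝ)) ≠ (6, 0) := by simp
  have hup : ((0 : ℝ), (0 : ℝ)) ≠ (0, 6) := by simp
  have hqw : ((1 : ℝ), (1 : ℝ)) ≠ (6, 0) := by simp
  have hpq : ((0 : ℝ), (6 : ℝ)) ≠ (1, 1) := by simp
  induction n with
  | zero =>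
    have h1 : (piece k 0).HasWalk 1 ((0, 0), 0) ((6, 0), endLabel k 1) :=
      chain_hasWalk huw one_ne_zero (by simp [endLabel])
    refine ⟨{((0, 0), 0), ((6, 0), endLabel k 1)}, Finset.card_pair fun h => huw (congrArg Prod.fst h),
      ?_, ?_⟩
    · intro x hx
      rcases Finset.mem_insert.1 hx with rfl | hx
      · exact ⟨0, by omega, .refl _ _, h1⟩
      · rw [Finset.mem_singleton.1 hx]
        exact ⟨1, le_rfl, h1, .refl _ _⟩
    · intro x hx y hy hxy
      refine ⟨1, odd_one, by omega, ?_⟩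
      simp only [Finset.mem_insert, Finset.mem_singleton] at hx hy
      rcases hx with rfl | rfl <;> rcases hy with rfl | rfl
      · exact absurd rfl hxy
      · exact h1
      · exact h1.symm
      · exact absurd rfl hxy
  | succ n ih =>
    obtain ⟨S, hcard, hS, hSS⟩ := ih (by omega)
    set f := move lowerMap (0 : Fin (2 * k + 1) → ZMod 2) with hf
    set g := move upperMap (step k (n + 1)) with hg
    have finj : Function.Injective f := move_injective lowerMap_injective _
    have ginj : Function.Injective g := move_injective upperMap_injective _
    have fsub : Prod.map f f '' piece k n ⊆ piece k (n + 1) := fun e he => Or.inl (Or.inr he)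
    have gsub : Prod.map g g '' piece k n ⊆ piece k (n + 1) := fun e he => Or.inr he
    have fwalk : ∀ {m a b}, (piece k n).HasWalk m a b → (piece k (n + 1)).HasWalk m (f a) (f b) :=
      fun h => (h.map lowerMap_injective _).mono fsub
    have gwalk : ∀ {m a b}, (piece k n).HasWalk m a b → (piece k (n + 1)).HasWalk m (g a) (g b) :=
      fun h => (h.map upperMap_injective _).mono gsub
    have fu : f ((0, 0), 0) = ((0, 0), 0) := move_lowerMap_left k
    have fw : f ((6, 0), endLabel k (n + 1)) = ((1, 1), endLabel k (n + 1)) :=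
      move_lowerMap_right _
    have gu : g ((0, 0), 0) = ((0, 6), step k (n + 1)) := move_upperMap_left _
    have gw : g ((6, 0), endLabel k (n + 1)) = ((6, 0), endLabel k (n + 2)) := by
      rw [endLabel_succ k (n + 1)]
      exact move_upperMap_right _ _
    have wup : (piece k (n + 1)).HasWalk 1 ((0, 0), 0) ((0, 6), step k (n + 1)) :=
      (chain_hasWalk hup one_ne_zero (by rw [sum_one_step, zero_add])).mono
        fun e he => Or.inl (Or.inl (Or.inl (Or.inl (Or.inr he))))
    have wqw : (piece k (n + 1)).HasWalk 1 ((1, 1), endLabel k (n + 1))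
        ((6, 0), endLabel k (n + 2)) :=
      (chain_hasWalk hqw one_ne_zero (by rw [sum_one_step, ← endLabel_succ])).mono
        fun e he => Or.inl (Or.inl (Or.inl (Or.inr he)))
    have wuw : (piece k (n + 1)).HasWalk (2 * k - (n + 1)) ((0, 0), 0)
        ((6, 0), endLabel k (n + 2)) := by
      rw [show 2 * k - (n + 1) = 2 * k + 1 - (n + 1 + 1) by omega]
      exact (chain_hasWalk huw (by omega) (bottom_label (by omega))).mono
        fun e he => Or.inl (Or.inl (Or.inl (Or.inl (Or.inl he))))
    have wpq : (piece k (n + 1)).HasWalk (2 * k - (n + 1)) ((0, 6), step k (n + 1))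
        ((1, 1), endLabel k (n + 1)) := by
      rw [show 2 * k - (n + 1) = 2 * k + 1 - (n + 1 + 1) by omega]
      exact (chain_hasWalk hpq (by omega) (middle_label (by omega))).mono
        fun e he => Or.inl (Or.inl (Or.inr he))
    have hfS : ∀ x ∈ S, ∃ c ≤ n + 1, (piece k (n + 1)).HasWalk c ((0, 0), 0) (f x) ∧
        (piece k (n + 1)).HasWalk (n + 1 - c) (f x) ((1, 1), endLabel k (n + 1)) := by
      intro x hx
      obtain ⟨c, hc, h1, h2⟩ := hS x hx
      exact ⟨c, hc, fu ▸ fwalk h1, fw ▸ fwalk h2⟩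
    have hgS : ∀ x ∈ S, ∃ c ≤ n + 1, (piece k (n + 1)).HasWalk c ((0, 6), step k (n + 1)) (g x) ∧
        (piece k (n + 1)).HasWalk (n + 1 - c) (g x) ((6, 0), endLabel k (n + 2)) := by
      intro x hx
      obtain ⟨c, hc, h1, h2⟩ := hS x hx
      exact ⟨c, hc, gu ▸ gwalk h1, gw ▸ gwalk h2⟩
    have hfg : ∀ x ∈ S, ∀ y ∈ S, ∃ m, Odd m ∧ m ≤ 2 * k - 1 ∧
        (piece k (n + 1)).HasWalk m (f x) (g y) := by
      intro x hx y hy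
      obtain ⟨c, hc, h1, h2⟩ := hfS x hx
      obtain ⟨d, hd, h3, h4⟩ := hgS y hy
      exact exists_odd_walk (by omega) hc hd wup wqw wuw wpq h1 h2 h3 h4
    -- A common vertex of the two copies would have a closed odd walk of length at most `2 * k - 1`,
    -- which the colouring forbids. No geometry is needed.
    have hdisj : Disjoint (S.image f) (S.image g) := by
      rw [Finset.disjoint_left]
      intro z hz hz'
      obtain ⟨x, hx, rfl⟩ := Finset.mem_image.1 hz
      obtain ⟨y, hy, hyx⟩ := Finset.mem_image.1 hz'
      obtain ⟨m, hodd, hm, hwalk⟩ := hfg x hx y hy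
      rw [hyx] at hwalk
      obtain ⟨p, rfl⟩ := hwalk
      have := (piece_isColoured hn).le_length p hodd
      omega
    refine ⟨S.image f ∪ S.image g, ?_, ?_, ?_⟩
    · rw [Finset.card_union_of_disjoint hdisj, Finset.card_image_of_injective _ finj,
        Finset.card_image_of_injective _ ginj, hcard]
      ring
    · intro z hz
      rcases Finset.mem_union.1 hz with hz | hz
      · obtain ⟨x, hx, rfl⟩ := Finset.mem_image.1 hz
        obtain ⟨c, hc, h1, h2⟩ := hfS x hx
        refine ⟨c, by omega, h1, ?_⟩
        rw [show n + 1 + 1 - c = n + 1 - c + 1 by omega]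
        exact h2.trans wqw
      · obtain ⟨x, hx, rfl⟩ := Finset.mem_image.1 hz
        obtain ⟨c, hc, h1, h2⟩ := hgS x hx
        refine ⟨1 + c, by omega, wup.trans h1, ?_⟩
        rw [show n + 1 + 1 - (1 + c) = n + 1 - c by omega]
        exact h2
    · intro z hz z' hz' hne
      rcases Finset.mem_union.1 hz with hz | hz <;> rcases Finset.mem_union.1 hz' with hz' | hz' <;>
        obtain ⟨x, hx, rfl⟩ := Finset.mem_image.1 hz <;>
        obtain ⟨y, hy, rfl⟩ := Finset.mem_image.1 hz'
      · obtain ⟨m, h1, h2, h3⟩ := hSS x hx y hy fun h => hne (h ▸ rfl)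
        exact ⟨m, h1, h2, fwalk h3⟩
      · exact hfg x hx y hy
      · obtain ⟨m, h1, h2, h3⟩ := hfg y hy x hx
        exact ⟨m, h1, h2, h3.symm⟩
      · obtain ⟨m, h1, h2, h3⟩ := hSS x hx y hy fun h => hne (h ▸ rfl)
        exact ⟨m, h1, h2, gwalk h3⟩

theorem piece_bottom_edge {k n : ℕ} (hn : n + 1 = 2 * k) :
    (piece k n).HasWalk 1 ((0, 0), 0) ((6, 0), endLabel k (n + 1)) := by
  -- As `n + 1` is even, `n` is not `0`, so the last piece has a frame; its bottom chain has `2 * k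
  -- + 1 - (n + 1) = 1` edge in the original `n`.
  obtain ⟨n, rfl⟩ : ∃ m, n = m + 1 := ⟨n - 1, by omega⟩
  have h := chain_hasWalk (g := step k) (a := ((0 : ℝ), (0 : ℝ))) (b := (6, 0)) (by simp)
    (by omega) (bottom_label (k := k) (n := n + 1) (by omega))
  have h := h.mono (E := piece k (n + 1)) fun e he => Or.inl (Or.inl (Or.inl (Or.inl (Or.inl he))))
  rwa [show 2 * k + 1 - (n + 1 + 1) = 1 by omega] at h

end Drawing

/-! ### The final graph -/

theorem mainTheorem1 (k : ℕ) (hk : 1 ≤ k) :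
    ∃ (V : Type) (_ : Fintype V) (G : SimpleGraph V),
      G.IsPlanar ∧ G.oddGirth = ((2 * k + 1 : ℕ) : ℕ∞) ∧
        2 ^ (2 * k) ≤ (G.walkPower (2 * k - 1)).cliqueNum := by
  classical
  obtain ⟨n, hn⟩ : ∃ n, n + 1 = 2 * k := ⟨2 * k - 1, by omega⟩
  obtain ⟨S, hcard, hS, hSS⟩ := Drawing.exists_clique hn.le
  have hcol := Drawing.piece_isColoured hn.le
  have hbottom := Drawing.piece_bottom_edge hn
  rw [hn] at hcard hS hbottom
  set D := Drawing.piece k n with hD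
  have hfin : Finite D.vertexSet :=
    (((Drawing.piece_finite k n).image _).union ((Drawing.piece_finite k n).image _)).to_subtype
  have hmin : ∀ (c : D.vertexSet) (q : (D.graph.induce D.vertexSet).Walk c c), Odd q.length →
      2 * k + 1 ≤ q.length := by
    intro c q hq
    have h := hcol.le_length (q.map (SimpleGraph.Embedding.induce D.vertexSet).toHom)
      (by rwa [SimpleGraph.Walk.length_map])
    rwa [SimpleGraph.Walk.length_map] at h
  have hlift : ∀ {m : ℕ} {a b} (ha : a ∈ D.vertexSet) (hb : b ∈ D.vertexSet), D.HasWalk m a b →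
      ∃ q : (D.graph.induce D.vertexSet).Walk ⟨a, ha⟩ ⟨b, hb⟩, q.length = m := by
    rintro m a b ha hb ⟨p, rfl⟩
    exact SimpleGraph.exists_walk_induce (fun a b => Drawing.mem_vertexSet_of_adj) ha hb p
  have hSV : ∀ x ∈ S, x ∈ D.vertexSet := by
    intro x hx
    obtain ⟨c, hc, h1, h2⟩ := hS x hx
    rcases Nat.eq_zero_or_pos c with rfl | hc
    · exact h2.mem_vertexSet (by omega)
    · exact h1.symm.mem_vertexSet hc
  refine ⟨D.vertexSet, Fintype.ofFinite _, D.graph.induce D.vertexSet,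
    (Drawing.piece_isPlane hn.le).1.isPlanar, ?_, ?_⟩
  · obtain ⟨x, hx⟩ : S.Nonempty := Finset.card_pos.1 (hcard ▸ by positivity)
    obtain ⟨c, hc, h1, h2⟩ := hS x hx
    have hu := hbottom.mem_vertexSet one_pos
    -- A walk of length `2 * k` between the terminals, closed by the bottom edge, attains the lower
    -- bound `2 * k + 1`.
    obtain ⟨p, hp⟩ := hlift hu hu ((h1.trans h2).trans hbottom.symm)
    exact SimpleGraph.oddGirth_eq_of_closed_walk p (by omega) ⟨k, rfl⟩ hmin
  · have hclique : (SimpleGraph.walkPower (D.graph.induce D.vertexSet) (2 * k - 1)).IsClique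
        (S.subtype (· ∈ D.vertexSet) : Finset D.vertexSet) := by
      rintro ⟨x, hxV⟩ hx ⟨y, hyV⟩ hy hne
      rw [Finset.mem_coe, Finset.mem_subtype] at hx hy
      obtain ⟨m, ⟨i, hi⟩, hm, hwalk⟩ := hSS x hx y hy fun h => hne (Subtype.ext h)
      obtain ⟨p, hp⟩ := hlift hxV hyV hwalk
      -- From length `2 * i + 1`, exactly `k - 1 - i` detours of length 2 lead to `2 * k - 1`.
      obtain ⟨q, hq⟩ := p.exists_length_add_two_mul (by omega) (k - 1 - i)
      exact ⟨hne, q, by omega⟩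
    have := hclique.card_le_cliqueNum
    rwa [Finset.card_subtype, Finset.filter_true_of_mem hSV, hcard] at this
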